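/- **Conventions.** A *value quantale* is a complete lattice $V$ with least element $0$ and greatest element $\infty$, $0<\infty$, and an associative commutative operation $+$ with $a+0=a$, $a+\bigwedge S=\bigwedge_{s\in S}(a+s)$ for all $a\in V$, $S\subseteq V$, $a=\bigwedge\{b: b\succ a\}$, and $a\wedge b\succ 0$ whenever $a,b\succ 0$. Here $a\prec b$ (or $b\succ a$) means: for every $S\subseteq V$ with $\bigwedge S\le a$ there is $s\in S$ with $s\le b$. A *space* $(V,X,d)$ is a set $X$, a value quantale $V$ and $d\colon X\times X\to V$ with $d(x,x)=0$ and $d(x,z)\le d(x,y)+d(y,z)$. It is *locally finite* if $d(x,y)<\infty$ for all $x,y\in X$. Its *open ball topology* is generated by the sets $\{y : d(x,y)\prec\varepsilon\}$, $x\in X$, $\varepsilon\succ 0$. A *scale* on it is a function $R\colon X\to V$ with $R(x)\succ 0$ for all $x$. An *$R$-walk* is a finite sequence of points in which any two consecutive points $x,y$ satisfy $d(x,y)\prec R(x)$ or $d(y,x)\prec R(y)$. A *scale system* $\Sigma$ assigns to every space a non-empty set of scales on it, its *$\Sigma$-scales*; $\Sigma_a$ is the scale system of all scales. A space is *$\Sigma$-connected*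 if it is non-empty and, for each $\Sigma$-scale $R$, any two of its points are joined by an $R$-walk. **Products.** Let $(V_i,X_i,d_i)_{i\in I}$ be a family of spaces indexed by a set $I$. Order and add coordinatewise in $V=\prod_i V_i$, and let $P\subseteq V$ be the set of all $a$ with $a_i\succ 0$ for all $i$ and $a_i=\infty$ for all but finitely many $i$. Let $W=\Gamma(V,P)$ be the value quantale of all sets $A\subseteq V$ such that $$a\in A\iff \exists\, b\in A,\ \exists\, p\in P:\ b+p\le a ,$$ ordered by reverse inclusion, with $A+B=\{c : \exists\, a\in A,\ b\in B,\ a+b\le c\}$ and zero element $P$. The map $v\mapsto\{a\in V : \exists\, p\in P,\ v+p\le a\}$ embeds $V$ in $W$. The *product metric* $d$ on $X=\prod_i X_i$ is the $W$-valued metric sending $(x,y)$ to the image of $(d_i(x_i,y_i))_{i}$ under this embedding. The *$i$-th coordinate* of $A\in W$ is $\bigwedge_{a\in A}a_i\in V_i$ (so the image of $v\in V$ has $i$-th coordinate $v_i$). A scale system $\Sigma$ is *product compatible* if for every such family, every $\Sigma$-scale $R$ on $(W,X,d)$, every $x\in X$ and every $i_0\in I$, the function $R_{i_0}\colon X_{i_0}\to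 V_{i_0}$ that sends $z$ to the $i_0$-th coordinate of $R(x')$, where $x'$ is $x$ with its $i_0$-th coordinate replaced by $z$, is a $\Sigma$-scale on $(V_{i_0},X_{i_0},d_{i_0})$. **Theorem.** 1. Let $\Sigma$ be a product compatible scale system and let $(V_i,X_i,d_i)_{i\in I}$ be a set-indexed family of spaces, each of which is locally finite and $\Sigma$-connected. Then the product $(W,X,d)$ is $\Sigma$-connected and locally finite. 2. The scale system $\Sigma_a$ of all scales is product compatible, and for every set-indexed family of spaces the open ball topology of $(W,X,d)$ is the product of the open ball topologies of the $(V_i,X_i,d_i)$. In particular, the product of any set-indexed family of connected topological spaces is connected. -/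

import Mathlib

universe u

/-- `WellBelow a b` is `a ≺ b`, i.e. `b` is well above `a`. -/
def WellBelow {V : Type u} [CompleteLattice V] (a b : V) : Prop :=
  ∀ S : Set V, sInf S ≤ a → ∃ s ∈ S, s ≤ b

/-- Flagg's value quantales. The bottom element is written both `⊥` and `0`; the top element
`⊤` is the `∞` of the quantale. -/
class ValueQuantale (V : Type u) extends CompleteLattice V, AddCommMonoid V where
  zero_eq_bot : (0 : V) = ⊥
  bot_lt_top : (⊥ : V) < ⊤
  add_sInf : ∀ (a : V) (S : Set V), a + sInf S = sInf ((fun s => a + s) '' S)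
  eq_sInf_wellAbove : ∀ a : V, a = sInf {b | WellBelow a b}
  inf_pos : ∀ a b : V, WellBelow 0 a → WellBelow 0 b → WellBelow 0 (a ⊓ b)

/-- A `V`-valued metric on `X`; no symmetry and no separation is required. -/
structure VMetric (V X : Type u) [ValueQuantale V] where
  dist : X → X → V
  dist_self : ∀ x, dist x x = 0
  dist_triangle : ∀ x y z, dist x z ≤ dist x y + dist y z

/-! ### Basic facts on value quantales -/

namespace ValueQuantale

variable {V : Type u} [ValueQuantale V]

theorem zero_le' (a : V) : 0 ≤ a := by
  rw [zero_eq_bot]; exact bot_le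

theorem add_le_add_left' (a : V) {b c : V} (h : b ≤ c) : a + b ≤ a + c := by
  have h1 := add_sInf a ({b, c} : Set V)
  rw [sInf_pair, inf_eq_left.2 h, Set.image_pair, sInf_pair] at h1
  rw [h1]; exact inf_le_right

theorem add_mono {a b c e : V} (h : a ≤ b) (h' : c ≤ e) : a + c ≤ b + e :=
  calc a + c ≤ a + e := add_le_add_left' a h'
    _ = e + a := add_comm _ _
    _ ≤ e + b := add_le_add_left' e h
    _ = b + e := add_comm _ _

theorem pos_of_le {a b : V} (ha : WellBelow 0 a) (h : a ≤ b) : WellBelow 0 b := by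
  intro S hS
  obtain ⟨s, hs, hsa⟩ := ha S hS
  exact ⟨s, hs, hsa.trans h⟩

theorem top_pos : WellBelow (0 : V) ⊤ := by
  intro S hS
  rcases S.eq_empty_or_nonempty with rfl | ⟨s, hs⟩
  · rw [sInf_empty, zero_eq_bot] at hS
    exact absurd hS (not_le_of_gt bot_lt_top)
  · exact ⟨s, hs, le_top⟩

theorem le_of_le_add_pos {a b : V} (h : ∀ e : V, WellBelow 0 e → a ≤ b + e) : a ≤ b := by
  have h1 := add_sInf b {e : V | WellBelow 0 e}
  rw [← eq_sInf_wellAbove, add_zero] at h1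
  rw [h1]
  refine le_sInf ?_
  rintro _ ⟨e, he, rfl⟩
  exact h e he

theorem exists_half {e : V} (he : WellBelow 0 e) : ∃ c : V, WellBelow 0 c ∧ c + c ≤ e := by
  obtain ⟨s, ⟨c, c', hc, hc', rfl⟩, hs⟩ :=
    he {s | ∃ c c' : V, WellBelow 0 c ∧ WellBelow 0 c' ∧ s = c + c'} (by
      refine le_of_le_add_pos fun c hc => ?_
      rw [zero_add]
      refine le_of_le_add_pos fun c' hc' => ?_
      exact sInf_le ⟨c, c', hc, hc', rfl⟩)
  exact ⟨c ⊓ c', inf_pos _ _ hc hc', (add_mono inf_le_left inf_le_right).trans hs⟩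

end ValueQuantale

/-! ### The value quantale of a value semigroup with a set of positives -/

/-- `P` is a set of positives in the ordered commutative monoid `M` (with binary meets and least
element `0`). -/
structure IsPositives {M : Type u} [SemilatticeInf M] [AddCommMonoid M] (P : Set M) : Prop where
  zero_le : ∀ a : M, 0 ≤ a
  add_mono : ∀ a b c e : M, a ≤ b → c ≤ e → a + c ≤ b + e
  nonempty : P.Nonempty
  upper : ∀ p q : M, p ∈ P → p ≤ q → q ∈ P
  inf_mem : ∀ p q : M, p ∈ P → q ∈ P → p ⊓ q ∈ P
  half : ∀ p ∈ P, ∃ q ∈ P, q + q ≤ p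
  separated : ∀ a b : M, (∀ p ∈ P, a ≤ b + p) → a ≤ b

/-- The carrier of `Γ(M, P)`: the round up-closed subsets `A` of `M`. Here `A` is up-closed and
round when `a ∈ A` holds exactly if `a` lies above `b + p` for some `b ∈ A` and some
positive `p`; automatically `A ⊆ P`. -/
@[ext]
structure RoundUpset {M : Type u} [SemilatticeInf M] [AddCommMonoid M] (P : Set M) : Type u where
  carrier : Set M
  mem_iff : ∀ a, a ∈ carrier ↔ ∃ b ∈ carrier, ∃ p ∈ P, b + p ≤ a

namespace RoundUpset

variable {M : Type u} [SemilatticeInf M] [AddCommMonoid M] {P : Set M}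

theorem upper (A : RoundUpset P) {a b : M} (ha : a ∈ A.carrier) (h : a ≤ b) : b ∈ A.carrier := by
  obtain ⟨c, hc, p, hp, hcp⟩ := (A.mem_iff a).1 ha
  exact (A.mem_iff b).2 ⟨c, hc, p, hp, hcp.trans h⟩

/-- The round up-closed sets are ordered by reverse inclusion. -/
instance : PartialOrder (RoundUpset P) where
  le A B := B.carrier ⊆ A.carrier
  le_refl _ := subset_rfl
  le_trans _ _ _ h h' := h'.trans h
  le_antisymm _ _ h h' := RoundUpset.ext (h'.antisymm h)

/-- Infima are unions. -/
instance : InfSet (RoundUpset P) where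
  sInf S :=
    { carrier := {a | ∃ A ∈ S, a ∈ A.carrier}
      mem_iff := by
        intro a
        constructor
        · rintro ⟨A, hA, ha⟩
          obtain ⟨b, hb, p, hp, h⟩ := (A.mem_iff a).1 ha
          exact ⟨b, ⟨A, hA, hb⟩, p, hp, h⟩
        · rintro ⟨b, ⟨A, hA, hb⟩, p, hp, h⟩
          exact ⟨A, hA, (A.mem_iff a).2 ⟨b, hb, p, hp, h⟩⟩ }

instance : CompleteLattice (RoundUpset P) :=
  completeLatticeOfInf _ fun S => by
    refine ⟨fun A hA a ha => ⟨A, hA, ha⟩, fun B hB a ha => ?_⟩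
    obtain ⟨A, hA, haA⟩ := ha
    exact hB hA haA

/-- The canonical map `v ↦ {a | v + p ≤ a for some positive p}` from `M` to `Γ(M, P)`. -/
def embed (hP : IsPositives P) (v : M) : RoundUpset P where
  carrier := {a | ∃ p ∈ P, v + p ≤ a}
  mem_iff := by
    intro a
    constructor
    · rintro ⟨p, hp, h⟩
      obtain ⟨q, hq, hqp⟩ := hP.half p hp
      refine ⟨v + q, ⟨q, hq, le_rfl⟩, q, hq, ?_⟩
      rw [add_assoc]
      exact (hP.add_mono _ _ _ _ le_rfl hqp).trans h
    · rintro ⟨b, ⟨p, hp, h⟩, q, hq, h'⟩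
      refine ⟨p, hp, h.trans (le_trans ?_ h')⟩
      simpa using hP.add_mono b b 0 q le_rfl (hP.zero_le q)

theorem embed_injective (hP : IsPositives P) : Function.Injective (embed hP) := by
  have key : ∀ v w : M, embed hP v = embed hP w → w ≤ v := by
    intro v w h
    refine hP.separated _ _ fun p hp => ?_
    have h1 : v + p ∈ (embed hP v).carrier := ⟨p, hp, le_rfl⟩
    rw [h] at h1
    obtain ⟨q, hq, h2⟩ := h1
    exact le_trans (by simpa using hP.add_mono w w 0 q le_rfl (hP.zero_le q)) h2
  exact fun v w h => (key w v h.symm).antisymm (key v w h)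

/-- The sum of `A` and `B` is the up-closure of `{a + b | a ∈ A, b ∈ B}`. -/
def sum (hP : IsPositives P) (A B : RoundUpset P) : RoundUpset P where
  carrier := {c | ∃ a ∈ A.carrier, ∃ b ∈ B.carrier, a + b ≤ c}
  mem_iff := by
    intro c
    constructor
    · rintro ⟨a, ha, b, hb, h⟩
      obtain ⟨a', ha', p, hp, hap⟩ := (A.mem_iff a).1 ha
      refine ⟨a' + b, ⟨a', ha', b, hb, le_rfl⟩, p, hp, le_trans ?_ h⟩
      rw [add_right_comm]
      exact hP.add_mono _ _ _ _ hap le_rfl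
    · rintro ⟨c', ⟨a, ha, b, hb, h⟩, p, hp, h'⟩
      refine ⟨a, ha, b, hb, h.trans (le_trans ?_ h')⟩
      simpa using hP.add_mono c' c' 0 p le_rfl (hP.zero_le p)

/-- The neutral element is the set of all positives. -/
def zero (hP : IsPositives P) : RoundUpset P where
  carrier := P
  mem_iff := by
    intro a
    constructor
    · intro ha
      obtain ⟨q, hq, h⟩ := hP.half a ha
      exact ⟨q, hq, q, hq, h⟩
    · rintro ⟨b, hb, p, _, h⟩
      refine hP.upper b a hb (le_trans ?_ h)
      simpa using hP.add_mono b b 0 p le_rfl (hP.zero_le p)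

theorem subset_positives (hP : IsPositives P) (A : RoundUpset P) : A.carrier ⊆ P := by
  intro a ha
  obtain ⟨b, _, p, hp, h⟩ := (A.mem_iff a).1 ha
  refine hP.upper p a hp (le_trans ?_ h)
  simpa using hP.add_mono 0 b p p (hP.zero_le b) le_rfl

theorem sum_zero (hP : IsPositives P) (A : RoundUpset P) : sum hP A (zero hP) = A :=
  RoundUpset.ext (Set.ext fun c => (A.mem_iff c).symm)

theorem sum_comm (hP : IsPositives P) (A B : RoundUpset P) : sum hP A B = sum hP B A := by
  refine RoundUpset.ext (Set.ext fun c => ⟨?_, ?_⟩)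
  · rintro ⟨a, ha, b, hb, h⟩
    exact ⟨b, hb, a, ha, by rwa [add_comm]⟩
  · rintro ⟨a, ha, b, hb, h⟩
    exact ⟨b, hb, a, ha, by rwa [add_comm]⟩

theorem sum_assoc (hP : IsPositives P) (A B C : RoundUpset P) :
    sum hP (sum hP A B) C = sum hP A (sum hP B C) := by
  refine RoundUpset.ext (Set.ext fun x => ⟨?_, ?_⟩)
  · rintro ⟨y, ⟨a, ha, b, hb, h⟩, c, hc, h'⟩
    refine ⟨a, ha, b + c, ⟨b, hb, c, hc, le_rfl⟩, le_trans ?_ h'⟩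
    rw [← add_assoc]
    exact hP.add_mono _ _ _ _ h le_rfl
  · rintro ⟨a, ha, y, ⟨b, hb, c, hc, h⟩, h'⟩
    refine ⟨a + b, ⟨a, ha, b, hb, le_rfl⟩, c, hc, le_trans ?_ h'⟩
    rw [add_assoc]
    exact hP.add_mono _ _ _ _ le_rfl h

theorem wellBelow_of_subset {A B : RoundUpset P} {a : M} (ha : a ∈ A.carrier)
    (hB : ∀ b ∈ B.carrier, a ≤ b) : WellBelow A B := by
  intro S hS
  obtain ⟨C, hC, haC⟩ := hS ha
  exact ⟨C, hC, fun b hb => C.upper haC (hB b hb)⟩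

theorem exists_of_wellBelow (hP : IsPositives P) {A B : RoundUpset P} (h : WellBelow A B) :
    ∃ a ∈ A.carrier, ∀ b ∈ B.carrier, a ≤ b := by
  obtain ⟨_, ⟨a, ha, rfl⟩, h'⟩ := h {C | ∃ a ∈ A.carrier, C = embed hP a} (by
    intro x hx
    obtain ⟨b, hb, p, hp, hx⟩ := (A.mem_iff x).1 hx
    exact ⟨_, ⟨b, hb, rfl⟩, p, hp, hx⟩)
  refine ⟨a, ha, fun b hb => ?_⟩
  obtain ⟨p, _, hpb⟩ := h' hb
  exact le_trans (by simpa using hP.add_mono a a 0 p le_rfl (hP.zero_le p)) hpb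

/-- The value quantale `Γ(M, P)`. -/
@[reducible]
def valueQuantale (hP : IsPositives P) : ValueQuantale (RoundUpset P) where
  add := sum hP
  zero := zero hP
  add_assoc := sum_assoc hP
  add_comm := sum_comm hP
  zero_add A := (sum_comm hP _ _).trans (sum_zero hP A)
  add_zero := sum_zero hP
  nsmul := @nsmulRec _ ⟨zero hP⟩ ⟨sum hP⟩
  nsmul_zero _ := rfl
  nsmul_succ _ _ := rfl
  zero_eq_bot := le_bot_iff.1 (show (⊥ : RoundUpset P).carrier ⊆ P from subset_positives hP _)
  bot_lt_top := by
    refine bot_lt_iff_ne_bot.2 fun h => ?_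
    obtain ⟨p, hp⟩ := hP.nonempty
    have h1 : (⊤ : RoundUpset P) ≤ sInf ∅ := le_sInf (by simp)
    have h2 : (⊤ : RoundUpset P) ≤ zero hP := h ▸ bot_le
    obtain ⟨A, hA, _⟩ := (le_trans (le_of_eq sInf_empty) h2) hp
    exact hA
  add_sInf A S := by
    refine RoundUpset.ext (Set.ext fun c => ⟨?_, ?_⟩)
    · rintro ⟨a, ha, b, ⟨B, hB, hb⟩, h⟩
      exact ⟨_, ⟨B, hB, rfl⟩, a, ha, b, hb, h⟩
    · rintro ⟨_, ⟨B, hB, rfl⟩, a, ha, b, hb, h⟩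
      exact ⟨a, ha, b, ⟨B, hB, hb⟩, h⟩
  eq_sInf_wellAbove A := by
    refine RoundUpset.ext (Set.ext fun c => ⟨?_, ?_⟩)
    · intro hc
      obtain ⟨b, hb, p, hp, h⟩ := (A.mem_iff c).1 hc
      refine ⟨embed hP b, wellBelow_of_subset hb ?_, p, hp, h⟩
      rintro x ⟨q, _, hx⟩
      exact le_trans (by simpa using hP.add_mono b b 0 q le_rfl (hP.zero_le q)) hx
    · rintro ⟨B, hB, hc⟩
      obtain ⟨a, ha, h⟩ := exists_of_wellBelow hP hB
      exact A.upper ha (h c hc)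
  inf_pos A B hA hB := by
    obtain ⟨p, hp, hpA⟩ := exists_of_wellBelow hP hA
    obtain ⟨q, hq, hqB⟩ := exists_of_wellBelow hP hB
    refine wellBelow_of_subset (a := p ⊓ q) (hP.inf_mem p q hp hq) ?_
    intro c hc
    have h1 : sInf {A, B} ≤ A ⊓ B := le_inf (sInf_le (by simp)) (sInf_le (by simp))
    obtain ⟨C, hC, hcC⟩ := h1 hc
    rcases hC with rfl | hC
    · exact inf_le_left.trans (hpA c hcC)
    · rw [Set.mem_singleton_iff] at hC
      subst hC
      exact inf_le_right.trans (hqB c hcC)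

end RoundUpset

/-! ### Products -/

section Products

variable {I : Type u} (V : I → Type u) [∀ i, ValueQuantale (V i)]

/-- The positives of the coordinatewise product. -/
def productPositives : Set (∀ i, V i) :=
  {a | (∀ i, WellBelow 0 (a i)) ∧ {i | a i ≠ ⊤}.Finite}

theorem productPositives_isPositives : IsPositives (productPositives V) where
  zero_le a i := ValueQuantale.zero_le' (a i)
  add_mono _ _ _ _ h h' i := ValueQuantale.add_mono (h i) (h' i)
  nonempty := ⟨⊤, fun _ => ValueQuantale.top_pos, by simp⟩
  upper p q hp h :=
    ⟨fun i => ValueQuantale.pos_of_le (hp.1 i) (h i),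
      hp.2.subset fun i hi hpi => hi (top_le_iff.1 (hpi ▸ h i))⟩
  inf_mem p q hp hq :=
    ⟨fun i => ValueQuantale.inf_pos _ _ (hp.1 i) (hq.1 i),
      (hp.2.union hq.2).subset fun i hi => by
        by_contra hc
        simp only [Set.mem_union, Set.mem_ofPred_eq, not_or, not_not] at hc
        exact hi (by simp [hc.1, hc.2])⟩
  half p hp := by
    classical
    choose c hc hcp using fun i => ValueQuantale.exists_half (hp.1 i)
    refine ⟨fun i => if p i = ⊤ then ⊤ else c i, ⟨fun i => ?_, hp.2.subset fun i hi hpi => ?_⟩,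
      fun i => ?_⟩
    · dsimp only
      split_ifs
      · exact ValueQuantale.top_pos
      · exact hc i
    · exact hi (if_pos hpi)
    · by_cases h : p i = ⊤
      · rw [h]; exact le_top
      · simpa [h] using hcp i
  separated a b h i := by
    classical
    refine ValueQuantale.le_of_le_add_pos fun e he => ?_
    have := h (Function.update ⊤ i e) ⟨fun j => ?_, (Set.finite_singleton i).subset fun j hj => ?_⟩ i
    · simpa using this
    · by_cases hj : j = i
      · subst hj; simpa using he
      · simpa [hj] using ValueQuantale.top_pos
    · by_contra hji
      exact hj (by simp [Set.mem_singleton_iff.not.1 hji])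

/-- The product value quantale `W = Γ(∏ V i)`. -/
abbrev ProductQuantale : Type u := RoundUpset (productPositives V)

instance : ValueQuantale (ProductQuantale V) :=
  RoundUpset.valueQuantale (productPositives_isPositives V)

variable {V}

/-- The `i`-th coordinate of an element of the product value quantale: the infimum-preserving
extension along the embedding of `∏ V i` of the `i`-th coordinate map. -/
def ProductQuantale.coord (i : I) (A : ProductQuantale V) : V i :=
  ⨅ a ∈ A.carrier, a i

variable {X : I → Type u}

/-- The coordinatewise metric on the product, regarded as valued in `ProductQuantale V`. -/
def productMetric (d : ∀ i, VMetric (V i) (X i)) :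
    VMetric (ProductQuantale V) (∀ i, X i) where
  dist x y := RoundUpset.embed (productPositives_isPositives V) fun i => (d i).dist (x i) (y i)
  dist_self x := by
    refine RoundUpset.ext (Set.ext fun a => ⟨?_, ?_⟩)
    · rintro ⟨p, hp, h⟩
      refine (productPositives_isPositives V).upper p a hp (le_trans (fun i => ?_) h)
      simp [(d i).dist_self]
    · intro ha
      refine ⟨a, ha, fun i => ?_⟩
      simp [(d i).dist_self]
  dist_triangle x y z := by
    rintro c ⟨a, ⟨p, hp, hpa⟩, b, ⟨q, hq, hqb⟩, h⟩
    refine ⟨p, hp, fun i => ?_⟩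
    refine le_trans ?_ (h i)
    refine le_trans ?_ (ValueQuantale.add_mono (hpa i) (hqb i))
    have h1 : (d i).dist (x i) (z i) + p i ≤
        ((d i).dist (x i) (y i) + (d i).dist (y i) (z i)) + (p i + q i) :=
      ValueQuantale.add_mono ((d i).dist_triangle _ _ _) (by
        simpa using ValueQuantale.add_mono (le_refl (p i)) (ValueQuantale.zero_le' (q i)))
    exact h1.trans (le_of_eq (by rw [add_add_add_comm]; rfl))

open Classical in
/-- For `R : ∏ X i → W`, the function on `X i` sending `z` to the `i`-th coordinate of the value
of `R` at the point obtained from `x` by replacing its `i`-th coordinate by `z`. -/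
noncomputable def sliceScale (R : (∀ i, X i) → ProductQuantale V) (x : ∀ i, X i) (i : I) :
    X i → V i :=
  fun z => ProductQuantale.coord i (R (Function.update x i z))

end Products

/-! ### Scale systems and connectedness -/

/-- A scale: a function all of whose values are well above `0`. -/
def IsScale {V X : Type u} [ValueQuantale V] (R : X → V) : Prop :=
  ∀ x, WellBelow 0 (R x)

/-- A scale system: a non-empty set of scales on every `V`-valued metric space. -/
structure ScaleSystem where
  scales : ∀ {V X : Type u} [ValueQuantale V], VMetric V X → Set (X → V)
  isScale : ∀ {V X : Type u} [ValueQuantale V] (d : VMetric V X), ∀ R ∈ scales d, IsScale R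
  nonempty : ∀ {V X : Type u} [ValueQuantale V] (d : VMetric V X), (scales d).Nonempty

/-- The scale system of all scales. -/
def ScaleSystem.all : ScaleSystem.{u} where
  scales _ := {R | IsScale R}
  isScale _ _ hR := hR
  nonempty _ := ⟨fun _ => ⊤, fun _ => ValueQuantale.top_pos⟩

/-- Product compatibility of a scale system. -/
def ScaleSystem.ProductCompatible (Sg : ScaleSystem.{u}) : Prop :=
  ∀ (I : Type u) (V X : I → Type u) [∀ i, ValueQuantale (V i)] (d : ∀ i, VMetric (V i) (X i)),
    ∀ R ∈ Sg.scales (productMetric d), ∀ (x : ∀ i, X i) (i : I),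
      sliceScale R x i ∈ Sg.scales (d i)

namespace VMetric

variable {V X : Type u} [ValueQuantale V] (d : VMetric V X)

/-- `(x, y)` is an `R`-step. -/
def Step (R : X → V) (x y : X) : Prop :=
  WellBelow (d.dist x y) (R x) ∨ WellBelow (d.dist y x) (R y)

/-- There is an `R`-walk, i.e. a finite sequence of `R`-steps, from `x` to `y`. -/
def Joined (R : X → V) (x y : X) : Prop :=
  Relation.ReflTransGen (d.Step R) x y

/-- `(V, X, d)` is connected with respect to the scale system. -/
def IsConnected (Sg : ScaleSystem.{u}) : Prop :=
  Nonempty X ∧ ∀ R ∈ Sg.scales d, ∀ x y : X, d.Joined R x y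

/-- All distances are `< ∞`. -/
def IsLocallyFinite : Prop :=
  ∀ x y : X, d.dist x y < ⊤

/-- The topology generated by the open balls `{y | d x y ≺ ε}` with `ε ≻ 0`. -/
@[reducible]
def openBallTopology : TopologicalSpace X :=
  TopologicalSpace.generateFrom
    {U | ∃ (x : X) (e : V), WellBelow 0 e ∧ U = {y | WellBelow (d.dist x y) e}}

end VMetric

/-!
Everything rests on one description of smallness in `Γ(M, P)`: the relation `A ≺ B` holds exactly
when some element of `A` is a lower bound of `B`. Hence `0 ≺ B` says that some positive `p` is a
lower bound of `B`, and `embed v ≺ B` says that `v + p` is one for some positive `p`. In the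
product, a positive differs from `⊤` in only finitely many coordinates, so a scale `R` constrains
only finitely many coordinates at each point.

* Connectedness. A walk in the factor `X i` for the slice of `R` through `x` becomes an `R`-walk in
  the product that moves the `i`-th coordinate only
  (`VMetric.Joined.update_of_sliceScale`): the strict inequality `d z w ≺ R_i z` leaves room for a
  positive in the `i`-th coordinate (`WellBelow.exists_add_le`), and the lower bound of `R`
  serves in the others. Thus finitely many coordinates can be changed along an `R`-walk
  (`VMetric.joined_piecewise`). Given `x` and `y`, change `y` into a point that agrees with `x` on
  the finitely many coordinates that `R x` constrains; this point is a single `R`-step away from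
  `x`.
* Topology. A ball of the product contains around each of its points a finite intersection of
  cylinders over balls, because the positive witnessing membership has finite support. Conversely,
  a cylinder over a ball contains around each of its points a product ball whose radius is the
  image of a positive that is `⊤` in all but one coordinate.
* Local finiteness. `⊤` in `Γ(M, P)` is the empty set, while every `embed v` contains `⊤ : M` when
  `M` is the product of the `V i`. So all distances in the product are below `⊤`, whether or not
  those in the factors are.
* For connected topological spaces the statement is Mathlib's instance on dependent products.
-/

/-! ### The well-below relation -/

section WellBelow

theorem WellBelow.le {V : Type u} [CompleteLattice V] {a b : V} (h : WellBelow a b) : a ≤ b := by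
  obtain ⟨s, rfl, hs⟩ := h {a} (by simp)
  exact hs

theorem WellBelow.trans_le {V : Type u} [CompleteLattice V] {a b c : V} (h : WellBelow a b)
    (hbc : b ≤ c) : WellBelow a c := fun S hS =>
  let ⟨s, hs, hsb⟩ := h S hS
  ⟨s, hs, hsb.trans hbc⟩

theorem WellBelow.of_le {V : Type u} [CompleteLattice V] {a b c : V} (hab : a ≤ b)
    (h : WellBelow b c) : WellBelow a c := fun S hS => h S (hS.trans hab)

variable {V : Type u} [ValueQuantale V]

theorem WellBelow.exists_between {a b : V} (h : WellBelow a b) :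
    ∃ c, WellBelow a c ∧ WellBelow c b := by
  obtain ⟨s, ⟨c, hac, hcs⟩, hsb⟩ := h {s | ∃ c, WellBelow a c ∧ WellBelow c s} (by
    conv_rhs => rw [ValueQuantale.eq_sInf_wellAbove a]
    refine le_sInf fun c hc => ?_
    rw [ValueQuantale.eq_sInf_wellAbove c]
    exact sInf_le_sInf fun s hs => ⟨c, hc, hs⟩)
  exact ⟨c, hac, hcs.trans_le hsb⟩

theorem WellBelow.exists_add_le {a b : V} (h : WellBelow a b) :
    ∃ e : V, WellBelow 0 e ∧ a + e ≤ b := by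
  obtain ⟨_, ⟨e, he, rfl⟩, hb⟩ := h ((fun s => a + s) '' {e : V | WellBelow 0 e}) (by
    rw [← ValueQuantale.add_sInf, ← ValueQuantale.eq_sInf_wellAbove, add_zero])
  exact ⟨e, he, hb⟩

theorem WellBelow.exists_add_wellBelow {a b : V} (h : WellBelow a b) :
    ∃ e : V, WellBelow 0 e ∧ WellBelow (a + e) b := by
  obtain ⟨c, hac, hcb⟩ := h.exists_between
  obtain ⟨e, he, hec⟩ := hac.exists_add_le
  exact ⟨e, he, WellBelow.of_le hec hcb⟩

theorem ValueQuantale.le_add_right' (a b : V) : a ≤ a + b := by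
  simpa using add_le_add_left' a (zero_le' b)

theorem ValueQuantale.top_add' (a : V) : ⊤ + a = ⊤ :=
  top_le_iff.1 (le_add_right' ⊤ a)

theorem ValueQuantale.add_top' (a : V) : a + ⊤ = ⊤ := by rw [add_comm, top_add']

end WellBelow

/-! ### Smallness in the product quantale -/

namespace ProductQuantale

variable {I : Type u} {V : I → Type u} [∀ i, ValueQuantale (V i)]

theorem zero_wellBelow_iff {B : ProductQuantale V} :
    WellBelow 0 B ↔ ∃ p ∈ productPositives V, ∀ b ∈ B.carrier, p ≤ b :=
  ⟨fun h => RoundUpset.exists_of_wellBelow (productPositives_isPositives V) h,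
    fun ⟨_, hp, h⟩ => RoundUpset.wellBelow_of_subset (A := 0) hp h⟩

theorem embed_wellBelow_iff {v : ∀ i, V i} {B : ProductQuantale V} :
    WellBelow (RoundUpset.embed (productPositives_isPositives V) v) B ↔
      ∃ p ∈ productPositives V, ∀ b ∈ B.carrier, v + p ≤ b := by
  constructor
  · intro h
    obtain ⟨a, ⟨p, hp, hpa⟩, ha⟩ :=
      RoundUpset.exists_of_wellBelow (productPositives_isPositives V) h
    exact ⟨p, hp, fun b hb => hpa.trans (ha b hb)⟩
  · rintro ⟨p, hp, h⟩
    exact RoundUpset.wellBelow_of_subset (a := v + p) ⟨p, hp, le_rfl⟩ h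

theorem le_of_mem_embed {v b : ∀ i, V i}
    (hb : b ∈ (RoundUpset.embed (productPositives_isPositives V) v).carrier) : v ≤ b := by
  obtain ⟨_, _, h⟩ := hb
  exact fun i => (ValueQuantale.le_add_right' _ _).trans (h i)

theorem zero_wellBelow_embed {v : ∀ i, V i} (hv : v ∈ productPositives V) :
    WellBelow 0 (RoundUpset.embed (productPositives_isPositives V) v) :=
  zero_wellBelow_iff.2 ⟨v, hv, fun _ hb => le_of_mem_embed hb⟩

theorem embed_lt_top (v : ∀ i, V i) :
    RoundUpset.embed (productPositives_isPositives V) v < ⊤ := by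
  refine lt_top_iff_ne_top.2 fun h => ?_
  have hmem : (⊤ : ∀ i, V i) ∈ (RoundUpset.embed (productPositives_isPositives V) v).carrier :=
    ⟨⊤, ⟨fun _ => ValueQuantale.top_pos, by simp⟩, le_top⟩
  have hle : sInf ∅ ≤ RoundUpset.embed (productPositives_isPositives V) v := by
    rw [h]; exact le_top
  have hle' : RoundUpset.embed (productPositives_isPositives V) v ≤ sInf ∅ := by
    rw [sInf_empty, h]
  -- The infimum of no elements is the union of no sets.
  rw [le_antisymm hle' hle] at hmem
  obtain ⟨A, hA, _⟩ := hmem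
  exact hA

theorem coord_le {A : ProductQuantale V} {a : ∀ i, V i} (ha : a ∈ A.carrier) (i : I) :
    coord i A ≤ a i :=
  iInf₂_le a ha

theorem coord_pos {A : ProductQuantale V} (hA : WellBelow 0 A) (i : I) :
    WellBelow 0 (coord i A) := by
  obtain ⟨p, hp, h⟩ := zero_wellBelow_iff.1 hA
  exact ValueQuantale.pos_of_le (hp.1 i) (le_iInf₂ fun a ha => h a ha i)

open Classical in
theorem update_mem_productPositives {p : ∀ i, V i} (hp : p ∈ productPositives V) (i : I)
    {e : V i} (he : WellBelow 0 e) : Function.update p i e ∈ productPositives V := by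
  refine ⟨fun j => ?_, (hp.2.insert i).subset fun j hj => ?_⟩
  · by_cases hj : j = i
    · subst hj; simpa using he
    · simpa [hj] using hp.1 j
  · by_cases hji : j = i
    · exact Or.inl hji
    · exact Or.inr (by simpa [hji] using hj)

end ProductQuantale

theorem ScaleSystem.all_productCompatible : ScaleSystem.all.{u}.ProductCompatible :=
  fun _ _ _ _ _ _ hR _ i _ => ProductQuantale.coord_pos (hR _) i

/-! ### Walks in products -/

namespace VMetric

theorem Joined.symm {V X : Type u} [ValueQuantale V] {d : VMetric V X} {R : X → V} {x y : X}
    (h : d.Joined R x y) : d.Joined R y x := by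
  induction h with
  | refl => exact Relation.ReflTransGen.refl
  | tail _ h ih => exact Relation.ReflTransGen.head (Or.symm h) ih

variable {I : Type u} {V X : I → Type u} [∀ i, ValueQuantale (V i)] (d : ∀ i, VMetric (V i) (X i))
  {R : (∀ i, X i) → ProductQuantale V}

open Classical in
theorem productMetric_wellBelow_of_sliceScale (hR : IsScale R) (x : ∀ i, X i) (i : I) {z w : X i}
    (h : WellBelow ((d i).dist z w) (sliceScale R x i z)) :
    WellBelow ((productMetric d).dist (Function.update x i z) (Function.update x i w))
      (R (Function.update x i z)) := by
  obtain ⟨p, hp, hpR⟩ := ProductQuantale.zero_wellBelow_iff.1 (hR (Function.update x i z))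
  obtain ⟨e, he, hle⟩ := h.exists_add_le
  refine ProductQuantale.embed_wellBelow_iff.2 ⟨Function.update p i e,
    ProductQuantale.update_mem_productPositives hp i he, fun b hb j => ?_⟩
  by_cases hj : j = i
  · subst hj
    simpa using hle.trans (ProductQuantale.coord_le hb j)
  · simpa [hj, (d j).dist_self] using hpR b hb j

open Classical in
/-- A walk in one factor, for the slice of `R` through `x`, lifts to an `R`-walk along the line
through `x` in the direction of that factor. -/
theorem Joined.update_of_sliceScale (hR : IsScale R) (x : ∀ i, X i) (i : I) {z w : X i}
    (h : (d i).Joined (sliceScale R x i) z w) :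
    (productMetric d).Joined R (Function.update x i z) (Function.update x i w) :=
  Relation.ReflTransGen.lift (Function.update x i)
    (fun _ _ => Or.imp (productMetric_wellBelow_of_sliceScale d hR x i)
      (productMetric_wellBelow_of_sliceScale d hR x i)) z w h

open Classical in
/-- If the factors are connected along all slices of `R`, then any finite set of coordinates can
be changed by an `R`-walk. -/
theorem joined_piecewise (hR : IsScale R)
    (hslice : ∀ (x : ∀ i, X i) (i : I) (z w : X i), (d i).Joined (sliceScale R x i) z w)
    (F : Finset I) (x y : ∀ i, X i) : (productMetric d).Joined R y (F.piecewise x y) := by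
  induction F using Finset.induction_on with
  | empty => rw [Finset.piecewise_empty]; exact Relation.ReflTransGen.refl
  | insert i F _ ih =>
    rw [Finset.piecewise_insert]
    have h := Joined.update_of_sliceScale d hR (F.piecewise x y) i
      (hslice (F.piecewise x y) i (F.piecewise x y i) (x i))
    rw [Function.update_eq_self] at h
    exact ih.trans h

/-- At each point a scale on the product constrains only finitely many coordinates: any point that
agrees with the given one there is one step away. -/
theorem exists_finset_wellBelow (hR : IsScale R) (x : ∀ i, X i) :
    ∃ F : Finset I, ∀ y : ∀ i, X i, (∀ i ∈ F, y i = x i) →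
      WellBelow ((productMetric d).dist x y) (R x) := by
  obtain ⟨p, hp, hpR⟩ := ProductQuantale.zero_wellBelow_iff.1 (hR x)
  refine ⟨hp.2.toFinset, fun y hy =>
    ProductQuantale.embed_wellBelow_iff.2 ⟨p, hp, fun b hb i => ?_⟩⟩
  by_cases hi : p i = ⊤
  · have := hpR b hb i
    rw [hi, top_le_iff] at this
    rw [this]; exact le_top
  · simpa [hy i (by simpa using hi), (d i).dist_self] using hpR b hb i

theorem productMetric_isConnected {Sg : ScaleSystem.{u}} (hSg : Sg.ProductCompatible)
    (hd : ∀ i, (d i).IsConnected Sg) : (productMetric d).IsConnected Sg := by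
  classical
  refine ⟨⟨fun i => (hd i).1.some⟩, fun R hR x y => ?_⟩
  have hRs : IsScale R := Sg.isScale _ R hR
  obtain ⟨F, hF⟩ := exists_finset_wellBelow d hRs x
  have hxy : (productMetric d).Joined R x (F.piecewise x y) :=
    Relation.ReflTransGen.single (Or.inl (hF _ fun i hi => Finset.piecewise_eq_of_mem _ _ _ hi))
  exact hxy.trans (joined_piecewise d hRs
    (fun x i z w => (hd i).2 _ (hSg I V X d R hR x i) z w) F x y).symm

theorem productMetric_isLocallyFinite : (productMetric d).IsLocallyFinite :=
  fun _ _ => ProductQuantale.embed_lt_top _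

/-! ### The open ball topology of products -/

theorem isOpen_ball {V X : Type u} [ValueQuantale V] (d : VMetric V X) (x : X) {e : V}
    (he : WellBelow 0 e) : @IsOpen X d.openBallTopology {y | WellBelow (d.dist x y) e} :=
  TopologicalSpace.isOpen_generateFrom_of_mem ⟨x, e, he, rfl⟩

theorem pi_le_openBallTopology :
    @Pi.topologicalSpace I X (fun i => (d i).openBallTopology) ≤
      (productMetric d).openBallTopology := by
  let : ∀ i, TopologicalSpace (X i) := fun i => (d i).openBallTopology
  refine le_generateFrom ?_
  rintro _ ⟨x, e, -, rfl⟩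
  refine isOpen_iff_mem_nhds.2 fun y hy => ?_
  obtain ⟨q, hq, hqe⟩ := ProductQuantale.embed_wellBelow_iff.1 hy
  -- Half of the room left at `y` is spent on moving away from `y`, the other half is kept.
  obtain ⟨r, hr, hrq⟩ := (productPositives_isPositives V).half q hq
  have hopen : IsOpen (Set.pi {i | r i ≠ ⊤} fun i => {z | WellBelow ((d i).dist (y i) z) (r i)}) :=
    isOpen_set_pi hr.2 fun i _ => (d i).isOpen_ball (y i) (hr.1 i)
  refine Filter.mem_of_superset (hopen.mem_nhds fun i _ => ?_) fun z hz => ?_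
  · simpa [(d i).dist_self] using hr.1 i
  · refine ProductQuantale.embed_wellBelow_iff.2 ⟨r, hr, fun b hb i => ?_⟩
    refine le_trans ?_ (hqe b hb i)
    refine le_trans ?_ (ValueQuantale.add_le_add_left' _ (hrq i))
    change (d i).dist (x i) (z i) + r i ≤ (d i).dist (x i) (y i) + (r i + r i)
    by_cases hi : r i = ⊤
    · rw [hi, ValueQuantale.top_add', ValueQuantale.add_top', ValueQuantale.add_top']
    · rw [← add_assoc]
      refine ValueQuantale.add_mono (((d i).dist_triangle _ (y i) _).trans ?_) le_rfl
      exact ValueQuantale.add_le_add_left' _ (WellBelow.le (hz i hi))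

theorem openBallTopology_le_pi :
    (productMetric d).openBallTopology ≤
      @Pi.topologicalSpace I X (fun i => (d i).openBallTopology) := by
  classical
  refine le_iInf fun i => ?_
  rw [← continuous_iff_le_induced]
  refine continuous_generateFrom_iff.2 ?_
  rintro _ ⟨x, e, -, rfl⟩
  let := (productMetric d).openBallTopology
  refine isOpen_iff_mem_nhds.2 fun y hy => ?_
  obtain ⟨δ, hδ, hδe⟩ := WellBelow.exists_add_wellBelow hy
  -- The radius that constrains the `i`-th coordinate only.
  have hv : Function.update (⊤ : ∀ i, V i) i δ ∈ productPositives V := by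
    convert ProductQuantale.update_mem_productPositives
      (p := ⊤) ⟨fun _ => ValueQuantale.top_pos, by simp⟩ i hδ
  have hpos := ProductQuantale.zero_wellBelow_embed hv
  refine Filter.mem_of_superset (((productMetric d).isOpen_ball y hpos).mem_nhds ?_) fun z hz => ?_
  · rw [Set.mem_ofPred_eq, (productMetric d).dist_self]; exact hpos
  · obtain ⟨q, -, hq⟩ := ProductQuantale.embed_wellBelow_iff.1 hz
    have hdist : (d i).dist (y i) (z i) ≤ δ := by
      have h := (productPositives_isPositives V).separated
        (fun i => (d i).dist (y i) (z i)) (Function.update ⊤ i δ)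
        (fun p hp j => (ValueQuantale.le_add_right' _ (q j)).trans (hq _ ⟨p, hp, le_rfl⟩ j)) i
      simpa using h
    exact WellBelow.of_le (((d i).dist_triangle x (y i) (z i)).trans
      (ValueQuantale.add_le_add_left' _ hdist)) hδe

end VMetric

theorem mainTheorem7 :
    (∀ Sg : ScaleSystem.{u}, Sg.ProductCompatible →
      ∀ (I : Type u) (V X : I → Type u) [∀ i, ValueQuantale (V i)]
        (d : ∀ i, VMetric (V i) (X i)),
        (∀ i, (d i).IsLocallyFinite) → (∀ i, (d i).IsConnected Sg) →
          (productMetric d).IsConnected Sg ∧ (productMetric d).IsLocallyFinite) ∧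
    ScaleSystem.all.{u}.ProductCompatible ∧
    (∀ (I : Type u) (V X : I → Type u) [∀ i, ValueQuantale (V i)]
      (d : ∀ i, VMetric (V i) (X i)),
      (productMetric d).openBallTopology =
        @Pi.topologicalSpace I X (fun i => (d i).openBallTopology)) ∧
    (∀ (I : Type u) (X : I → Type u) [∀ i, TopologicalSpace (X i)],
      (∀ i, ConnectedSpace (X i)) → ConnectedSpace (∀ i, X i)) := by
  refine ⟨fun Sg hSg I V X _ d _ hd => ⟨VMetric.productMetric_isConnected d hSg hd,
    VMetric.productMetric_isLocallyFinite d⟩, ScaleSystem.all_productCompatible,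
    fun I V X _ d => le_antisymm (VMetric.openBallTopology_le_pi d)
      (VMetric.pi_le_openBallTopology d), fun I X _ _ => inferInstance⟩
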